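/- A permutation $\sigma$ of $[m]=\{1,\dots,m\}$ is \emph{layered with layers of sizes} $(\ell_1,\dots,\ell_k)$ if $[m]$ can be partitioned into nonempty consecutive intervals $I_1<\dots<I_k$ with $|I_j|=\ell_j$ such that $\sigma$ is decreasing on each $I_j$ and $\sigma(x)<\sigma(x')$ whenever $x\in I_j$, $x'\in I_{j'}$ and $j<j'$. For $n\ge m$ the density of $\sigma$ in a permutation $\pi$ of $[n]$ is the probability that $m$ random distinct points $i_1<\dots<i_m$ of $[n]$ satisfy $\sigma(j)<\sigma(j')\iff\pi(i_j)<\pi(i_{j'})$ for all $j,j'\in[m]$. The \emph{packing density} of $\sigma$ is the limit, as $n\to\infty$, of the maximum density of $\sigma$ in a permutation of $[n]$. A \emph{permuton} is a Borel probability measure $\Pi$ on $[0,1]^2$ with uniform marginals, i.e. $\Pi([a,b]\times[0,1])=\Pi([0,1]\times[a,b])=b-a$ for all $0\le a\le b\le 1$. The density $d(\sigma,\Pi)$ is the probability that $m$ independent $\Pi$-random points, sorted by their $x$-coordinates as $(x_1,y_1),\dots,(x_m,y_m)$ with $x_1<\dots<x_m$, satisfy $\sigma(i)<\sigma(j)\iff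 y_i<y_j$ for all $i,j\in[m]$. The permuton $\Pi$ is \emph{$\sigma$-optimal} if $d(\sigma,\Pi)$ equals the packing density of $\sigma$. A permuton $\Pi$ is \emph{layered} if there is a collection $\mathcal J$ of closed subintervals $[a,b]$ of $[0,1]$ (where $a=b$ is allowed), none of which meets the interior $(a,b)$ of another, such that the support of $\Pi$ is $$\{(x,y) : x\in[a,b] \text{ and } y=b-(x-a) \text{ for some } [a,b]\in\mathcal J\}.$$ The collection $\mathcal J$ is then uniquely determined by $\Pi$, and its members are the \emph{layers} of $\Pi$. \textbf{Theorem.} Let $\sigma$ be a layered permutation with layers of sizes $(\ell_1,\dots,\ell_k)$, where $k\ge 2$. If $\ell_1\ge 2$, $\ell_k\ge 2$ and $\ell_i+\ell_{i+1}\ge\max\{\ell_1,\ell_k\}+1$ for every $i\in\{1,\dots,k-1\}$, then every $\sigma$-optimal layered permuton has finitely many layers. -/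

import Mathlib

open MeasureTheory Filter Topology

/-- `IsLayeredWith σ ℓ`: the permutation `σ` of order `m` is layered with (nonempty) layers of sizes
`ℓ 0, …, ℓ (k - 1)`.  The map `c` sends an element to the index of its layer: as `c` is monotone,
its fibres are intervals which follow each other in the order of their indices. -/
def IsLayeredWith {m k : ℕ} (σ : Equiv.Perm (Fin m)) (ℓ : Fin k → ℕ) : Prop :=
  (∀ i, 0 < ℓ i) ∧
  ∃ c : Fin m → Fin k, Monotone c ∧
    (∀ i, (Finset.univ.filter fun x => c x = i).card = ℓ i) ∧
    (∀ x y, c x = c y → x < y → σ y < σ x) ∧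
    (∀ x y, c x < c y → σ x < σ y)

/-- The density of the pattern `σ` (of order `m`) in the permutation `π` of order `n ≥ m`:
the proportion of the `m`-element subsets `{f 0 < ⋯ < f (m - 1)}` of the `n` points that
induce `σ`. -/
noncomputable def patternDensity {m n : ℕ} (σ : Equiv.Perm (Fin m)) (π : Equiv.Perm (Fin n)) : ℝ :=
  (Nat.card {f : Fin m ↪o Fin n // ∀ i j, σ i < σ j ↔ π (f i) < π (f j)} : ℝ) / (n.choose m : ℝ)

/-- The maximum density of `σ` in a permutation of order `n`. -/
noncomputable def maxPatternDensity {m : ℕ} (σ : Equiv.Perm (Fin m)) (n : ℕ) : ℝ :=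
  (Finset.univ : Finset (Equiv.Perm (Fin n))).sup' Finset.univ_nonempty (patternDensity σ)

/-- `δ` is the packing density of `σ`: the limit, as `n → ∞`, of the maximum density of `σ` in a
permutation of order `n`. -/
def IsPackingDensity {m : ℕ} (σ : Equiv.Perm (Fin m)) (δ : ℝ) : Prop :=
  Tendsto (maxPatternDensity σ) atTop (𝓝 δ)

/-- A permuton: a Borel probability measure on `[0,1]²` with uniform marginals. -/
structure Permuton where
  toMeasure : Measure (unitInterval × unitInterval)
  isProbabilityMeasure : IsProbabilityMeasure toMeasure
  fst_marginal : ∀ a b : unitInterval, a ≤ b →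
    toMeasure (Set.Icc a b ×ˢ Set.univ) = ENNReal.ofReal ((b : ℝ) - a)
  snd_marginal : ∀ a b : unitInterval, a ≤ b →
    toMeasure (Set.univ ×ˢ Set.Icc a b) = ENNReal.ofReal ((b : ℝ) - a)

/-- The points `p 0, …, p (m - 1)` induce `σ`: once they are sorted (by `τ`) according to their
`x`-coordinates, which are required to be distinct, the relative order of their `y`-coordinates
is `σ`. -/
def PointsInduce {m : ℕ} (σ : Equiv.Perm (Fin m)) (p : Fin m → unitInterval × unitInterval) : Prop :=
  ∃ τ : Equiv.Perm (Fin m), StrictMono (fun i => (p (τ i)).1) ∧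
    ∀ i j, σ i < σ j ↔ (p (τ i)).2 < (p (τ j)).2

namespace Permuton

/-- The density of `σ` in the permuton `P`: the probability that `m` independent `P`-random points
induce `σ`. -/
noncomputable def density {m : ℕ} (σ : Equiv.Perm (Fin m)) (P : Permuton) : ℝ :=
  (Measure.pi fun _ : Fin m => P.toMeasure).real {p | PointsInduce σ p}

/-- `P` is `σ`-optimal: the density of `σ` in `P` is the packing density of `σ`. -/
def IsOptimal {m : ℕ} (σ : Equiv.Perm (Fin m)) (P : Permuton) : Prop :=
  IsPackingDensity σ (P.density σ)

/-- `P` is a layered permuton with set of layers `J`: the members of `J` are closed subintervals of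
`[0,1]` (possibly single points), no member meets the interior of another one, and the support of
`P` is the union of the antidiagonals of the squares `[a,b]²` over `[a,b] ∈ J`. -/
structure HasLayers (P : Permuton) (J : Set (NonemptyInterval unitInterval)) : Prop where
  internally_disjoint : J.Pairwise fun K L =>
    Disjoint (Set.Ioo K.fst K.snd) (Set.Icc L.fst L.snd)
  support_eq : P.toMeasure.support =
    {p | ∃ K ∈ J, p.1 ∈ Set.Icc K.fst K.snd ∧ (p.2 : ℝ) = K.snd - ((p.1 : ℝ) - K.fst)}

end Permuton

/-! Encode a layered permuton by the equivalence relation on [0,1] whose classes are the interiors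
of its layers and the remaining single points. Its density of σ is at most m! times the measure of
`sortedFit`, the increasing tuples whose classes are the blocks of σ (`density_le`). Conversely, for
every measurable relation with convex classes this quantity is at most the packing density: sample n
points, reverse each class, and average the number of copies of σ. So the relation of an optimal
layered permuton maximises the measure of `sortedFit`, and may be tested against modifications.

The modification makes a saturated interval B a single class. Let g be the probability that two
random points lie in B and are unrelated. Placing a block of size t ≥ 2 in B gains at least a
multiple of |B|^(t-2) g (`outerFit_mul_le`). A lost tuple has two consecutive blocks in B, so the
loss is at most k |B|^(e-2) g if any two consecutive blocks have at least e points together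
(`sortedFit_diff_le`). The factor g cancels, however small it is.

Infinitely many nondegenerate layers would contain a monotone sequence. Let B span two neighbours
far along it, and keep the other blocks in fixed early layers; the block sent to B is the last one
if the sequence increases, the first one if it decreases. As e ≥ t + 1, the loss has an extra factor
|B|, which tends to 0 while the room for the other blocks does not: a contradiction.

If the finitely many nondegenerate layers miss a point, they miss an open interval, where the
relation is equality. Merging there loses nothing, since one of any two consecutive blocks has at
least two points; so the gain is null. But every fitting tuple has a block of size at least two that
could be moved there, so `sortedFit` is null, which is absurd. Hence these layers cover [0,1], and
single-point layers are among their endpoints. -/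

/-! ### Product measures and coordinate maps -/

open ProbabilityTheory in
/-- The coordinates indexed by `S` all lie in `B`, two of them are related by `A`, and the other
coordinates satisfy `V`: the probability of this under a product measure. -/
theorem measure_pi_block {ι X : Type*} [Fintype ι] [DecidableEq ι] [MeasurableSpace X]
    (μ : Measure X) [IsProbabilityMeasure μ] (S : Finset ι) {i₀ i₁ : ι} (h₀ : i₀ ∈ S) (h₁ : i₁ ∈ S)
    (hne : i₀ ≠ i₁) {B : Set X} (hB : MeasurableSet B) {A : Set (X × X)} (hA : MeasurableSet A)
    {V : Set ((Sᶜ : Finset ι) → X)} (hV : MeasurableSet V) :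
    Measure.pi (fun _ : ι => μ)
      {x | (∀ i ∈ S, x i ∈ B) ∧ (x i₀, x i₁) ∈ A ∧ (fun i : (Sᶜ : Finset ι) => x i) ∈ V} =
    Measure.pi (fun _ : ι => μ) {x | (fun i : (Sᶜ : Finset ι) => x i) ∈ V} *
      (μ B ^ (S.card - 2) * (μ.prod μ) (A ∩ B ×ˢ B)) := by
  set ν := Measure.pi (fun _ : ι => μ) with hν
  have hind : iIndepFun (fun (i : ι) (x : ι → X) => x i) ν :=
    iIndepFun_pi (X := fun _ => id) (fun _ => aemeasurable_id)
  have hm : ∀ i : ι, Measurable (fun x : ι → X => x i) := fun i => measurable_pi_apply i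
  have hS := hind.indepFun_finset Sᶜ S disjoint_compl_left hm
  set T : Finset ι := S \ {i₀, i₁} with hT
  have hT' := hind.indepFun_finset T {i₀, i₁} Finset.sdiff_disjoint hm
  have hpair : ν.map (fun x => (x i₀, x i₁)) = μ.prod μ := by
    have h := (indepFun_iff_map_prod_eq_prod_map_map (hm i₀).aemeasurable (hm i₁).aemeasurable).1
      (hind.indepFun hne)
    rw [h, (measurePreserving_eval (fun _ : ι => μ) i₀).map_eq,
      (measurePreserving_eval (fun _ : ι => μ) i₁).map_eq]
  have hAB : MeasurableSet (A ∩ B ×ˢ B) := hA.inter (hB.prod hB)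
  have e1 : {x : ι → X | (∀ i ∈ S, x i ∈ B) ∧ (x i₀, x i₁) ∈ A ∧
      (fun i : (Sᶜ : Finset ι) => x i) ∈ V} =
      (fun x (i : (Sᶜ : Finset ι)) => x i) ⁻¹' V ∩
      (fun x (i : S) => x i) ⁻¹' {y | (∀ i, y i ∈ B) ∧ (y ⟨i₀, h₀⟩, y ⟨i₁, h₁⟩) ∈ A} := by
    ext x; simp; tauto
  have e2 : (fun (x : ι → X) (i : S) => x i) ⁻¹'
      {y | (∀ i, y i ∈ B) ∧ (y ⟨i₀, h₀⟩, y ⟨i₁, h₁⟩) ∈ A} =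
      (fun x (i : T) => x i) ⁻¹' {y | ∀ i, y i ∈ B} ∩
      (fun x (i : ({i₀, i₁} : Finset ι)) => x i) ⁻¹'
        {y | (y ⟨i₀, by simp⟩, y ⟨i₁, by simp⟩) ∈ A ∩ B ×ˢ B} := by
    ext x
    simp only [Set.mem_preimage, Set.mem_ofPred_eq, Set.mem_inter_iff, Set.mem_prod, Subtype.forall]
    constructor
    · rintro ⟨h, hA⟩
      exact ⟨fun i hi => h i (Finset.sdiff_subset hi), hA, h _ h₀, h _ h₁⟩
    · rintro ⟨h, hA, hb₀, hb₁⟩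
      refine ⟨fun i hi => ?_, hA⟩
      by_cases hi' : i ∈ T
      · exact h i hi'
      · have : i = i₀ ∨ i = i₁ := by
          simp [hT, hi] at hi'; tauto
        rcases this with rfl | rfl <;> assumption
  have mB : MeasurableSet {y : T → X | ∀ i, y i ∈ B} :=
    measurableSet_setOfPred.2 (Measurable.forall fun i => measurableSet_setOfPred.1 (measurable_pi_apply i hB))
  rw [e1, hS.measure_inter_preimage_eq_mul _ _ hV, e2, hT'.measure_inter_preimage_eq_mul _ _ mB]
  · congr 2
    · have e3 : (fun (x : ι → X) (i : T) => x i) ⁻¹' {y | ∀ i, y i ∈ B} =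
          Set.univ.pi (fun i => if i ∈ T then B else Set.univ) := by
        ext x
        simp only [Set.mem_preimage, Set.mem_ofPred_eq, Subtype.forall, Set.mem_univ_pi]
        refine forall_congr' fun i => ?_
        by_cases hi : i ∈ T <;> simp [hi]
      rw [e3, hν, Measure.pi_pi]
      have : ∀ i, μ (if i ∈ T then B else Set.univ) = if i ∈ T then μ B else 1 := by
        intro i; split_ifs <;> simp
      simp_rw [this]
      rw [Finset.prod_ite_mem, Finset.univ_inter, Finset.prod_const, hT, Finset.card_sdiff_of_subset
        (by intro i; simp; rintro (rfl | rfl) <;> assumption), Finset.card_pair hne]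
    · rw [← hpair, Measure.map_apply ((hm _).prodMk (hm _)) hAB]
      rfl
  · exact ((measurable_pi_apply _).prodMk (measurable_pi_apply _)) hAB
  · exact (measurableSet_setOfPred.2 (Measurable.forall fun i => measurableSet_setOfPred.1 (measurable_pi_apply i hB))).inter
      (((measurable_pi_apply _).prodMk (measurable_pi_apply _)) hA)

/-- Used with a permutation, to sum over the orders in which a tuple may be sorted, and with an
embedding, to pick m points of an n-point sample. -/
theorem measurePreserving_comp_injective {ι κ X : Type*} [Fintype ι] [Fintype κ]
    [MeasurableSpace X] (μ : Measure X) [IsProbabilityMeasure μ] {g : ι → κ}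
    (hg : Function.Injective g) :
    MeasurePreserving (fun (x : κ → X) => x ∘ g) (Measure.pi fun _ => μ)
      (Measure.pi fun _ => μ) := by
  classical
  have hm : Measurable (fun (x : κ → X) => x ∘ g) :=
    measurable_pi_lambda _ fun i => measurable_pi_apply _
  refine ⟨hm, ?_⟩
  symm
  refine Measure.pi_eq fun s hs => ?_
  rw [Measure.map_apply hm (MeasurableSet.univ_pi hs)]
  have : (fun (x : κ → X) => x ∘ g) ⁻¹' Set.univ.pi s =
      Set.univ.pi (fun j => ⋂ (i : ι) (_ : g i = j), s i) := by
    ext x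
    simp only [Set.mem_preimage, Set.mem_univ_pi, Set.mem_iInter, Function.comp]
    exact ⟨fun h j i hij => hij ▸ h i, fun h i => h _ i rfl⟩
  rw [this, Measure.pi_pi]
  have h1 : ∏ j ∈ Finset.univ.image g, μ (⋂ (i : ι) (_ : g i = j), s i) = ∏ i, μ (s i) := by
    rw [Finset.prod_image fun a _ b _ h => hg h]
    refine Finset.prod_congr rfl fun i _ => ?_
    congr 1
    ext y
    simp only [Set.mem_iInter]
    exact ⟨fun h => h i rfl, fun h a ha => hg ha ▸ h⟩
  rw [← h1]
  symm
  refine Finset.prod_subset (Finset.subset_univ _) fun j _ hj => ?_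
  have : (⋂ (i : ι) (_ : g i = j), s i) = Set.univ := by
    ext y
    simp only [Set.mem_iInter, Set.mem_univ, iff_true]
    intro i hi
    exact absurd (Finset.mem_image.2 ⟨i, Finset.mem_univ _, hi⟩) hj
  rw [this, measure_univ]

theorem ae_injective_pi {ι X : Type*} [Fintype ι] [MeasurableSpace X] [MeasurableEq X]
    (μ : Measure X) [IsProbabilityMeasure μ] [NullSingletonClass μ] :
    ∀ᵐ x ∂(Measure.pi fun _ : ι => μ), Function.Injective x := by
  classical
  have h : ∀ i j : ι, i ≠ j → ∀ᵐ x ∂(Measure.pi fun _ : ι => μ), x i ≠ x j := by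
    intro i j hij
    have hd : MeasurableSet {p : X × X | p.1 = p.2} := measurableSet_diagonal
    have := measure_pi_block μ Finset.univ (Finset.mem_univ i) (Finset.mem_univ j) hij
      (B := Set.univ) MeasurableSet.univ hd
      (V := Set.univ) MeasurableSet.univ
    rw [ae_iff]
    have e : (μ.prod μ) ({p : X × X | p.1 = p.2} ∩ Set.univ ×ˢ Set.univ) = 0 := by
      rw [Set.univ_prod_univ, Set.inter_univ, Measure.prod_apply hd]
      simp [Set.preimage]
    rw [e] at this
    simpa using this
  have : ∀ᵐ x ∂(Measure.pi fun _ : ι => μ), ∀ i j, i ≠ j → x i ≠ x j := by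
    rw [ae_all_iff]; intro i
    rw [ae_all_iff]; intro j
    by_cases hij : i = j
    · simp [hij]
    · simpa [hij] using h i j hij
  filter_upwards [this] with x hx i j hij
  by_contra hne
  exact hx i j hne hij

/-! ### Relations with convex classes -/

/-- A measurable equivalence relation on `[0,1]` whose classes are convex. -/
structure IsIntervalRel (r : unitInterval → unitInterval → Prop) : Prop where
  equivalence : Equivalence r
  convex : ∀ ⦃u v w⦄, u ≤ v → v ≤ w → r u w → r u v
  measurableSet : MeasurableSet {p : unitInterval × unitInterval | r p.1 p.2}

/-- The increasing tuples in which the coordinates related by `r` are those with equal index under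
`c`. -/
def sortedFit {m k : ℕ} (c : Fin m → Fin k) (r : unitInterval → unitInterval → Prop) :
    Set (Fin m → unitInterval) :=
  {x | StrictMono x ∧ ∀ i j, r (x i) (x j) ↔ c i = c j}

namespace IsIntervalRel

variable {r : unitInterval → unitInterval → Prop}

theorem convex_right (hr : IsIntervalRel r) {u v w : unitInterval} (huv : u ≤ v) (hvw : v ≤ w)
    (h : r u w) : r v w :=
  hr.equivalence.trans (hr.equivalence.symm (hr.convex huv hvw h)) h

theorem measurable_eval (hr : IsIntervalRel r) {α : Type*} [MeasurableSpace α]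
    {f g : α → unitInterval} (hf : Measurable f) (hg : Measurable g) :
    Measurable fun x => r (f x) (g x) :=
  measurableSet_setOfPred.1 ((hf.prodMk hg) hr.measurableSet)

theorem measurableSet_sortedFit (hr : IsIntervalRel r) {m k : ℕ} (c : Fin m → Fin k) :
    MeasurableSet (sortedFit c r) := by
  refine measurableSet_setOfPred.2 (Measurable.and ?_ ?_)
  · refine measurableSet_setOfPred.1 ?_
    have : {x : Fin m → unitInterval | StrictMono x} = {x | ∀ i j, i < j → x i < x j} := by
      ext x; rfl
    rw [this]
    exact measurableSet_setOfPred.2 (Measurable.forall fun i => Measurable.forall fun j =>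
      Measurable.imp (by fun_prop) (measurableSet_setOfPred.1
        (measurableSet_lt (measurable_pi_apply i) (measurable_pi_apply j))))
  · exact Measurable.forall fun i => Measurable.forall fun j =>
      (hr.measurable_eval (measurable_pi_apply i) (measurable_pi_apply j)).iff (by fun_prop)

end IsIntervalRel

/-! ### From relations to finite permutations: the packing density as an upper bound -/

theorem exists_perm_lt_iff {n : ℕ} {α : Type*} [LinearOrder α] {g : Fin n → α}
    (hg : Function.Injective g) : ∃ π : Equiv.Perm (Fin n), ∀ i j, π i < π j ↔ g i < g j := by
  have hs : StrictMono (g ∘ Tuple.sort g) :=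
    (Tuple.monotone_sort g).strictMono_of_injective (hg.comp (Tuple.sort g).injective)
  refine ⟨(Tuple.sort g)⁻¹, fun i j => ?_⟩
  rw [← hs.lt_iff_lt]
  simp

theorem exists_strictMono_comp {n : ℕ} {α : Type*} [LinearOrder α] {x : Fin n → α}
    (hx : Function.Injective x) : ∃ τ : Equiv.Perm (Fin n), StrictMono (x ∘ τ) :=
  ⟨Tuple.sort x, (Tuple.monotone_sort x).strictMono_of_injective
    (hx.comp (Tuple.sort x).injective)⟩

/-- The permutation which reverses each class of `r` among the points of an increasing tuple. -/
theorem IsIntervalRel.exists_perm {r : unitInterval → unitInterval → Prop} (hr : IsIntervalRel r)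
    {n : ℕ} {x : Fin n → unitInterval} (hx : StrictMono x) :
    ∃ π : Equiv.Perm (Fin n), ∀ i j, i < j → (π i < π j ↔ ¬ r (x i) (x j)) := by
  classical
  let s : Fin n → Finset (Fin n) := fun i => Finset.univ.filter fun j => r (x j) (x i)
  have hs : ∀ i, (s i).Nonempty := fun i => ⟨i, by simp [s, hr.equivalence.refl]⟩
  let F : Fin n → Fin n := fun i => (s i).min' (hs i)
  have hFmem : ∀ i, r (x (F i)) (x i) := fun i => by
    simpa [s] using (s i).min'_mem (hs i)
  have hFle : ∀ i, F i ≤ i := fun i => (s i).min'_le i (by simp [s, hr.equivalence.refl])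
  have hF : ∀ i j, r (x i) (x j) → F i = F j := by
    intro i j h
    have : s i = s j := by
      ext a
      simp only [s, Finset.mem_filter, Finset.mem_univ, true_and]
      exact ⟨fun ha => hr.equivalence.trans ha h,
        fun ha => hr.equivalence.trans ha (hr.equivalence.symm h)⟩
    simp only [F, this]
  -- Lexicographic key: first the least index of the class, then the index in reverse order.
  let g : Fin n → Fin n ×ₗ (Fin n)ᵒᵈ := fun i => toLex (F i, OrderDual.toDual i)
  have hg : Function.Injective g := by
    intro i j h
    have := congrArg (fun p => (ofLex p).2) h
    simpa [g] using this
  obtain ⟨π, hπ⟩ := exists_perm_lt_iff hg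
  refine ⟨π, fun i j hij => ?_⟩
  rw [hπ]
  simp only [g, Prod.Lex.toLex_lt_toLex, OrderDual.toDual_lt_toDual]
  constructor
  · rintro (h | ⟨-, h⟩) hrr
    · exact h.ne (hF i j hrr)
    · exact absurd h hij.not_gt
  · intro h
    left
    refine lt_of_not_ge fun hle => h ?_
    have h1 : F j ≤ i := hle.trans (hFle i)
    exact hr.convex_right (hx.monotone h1) (hx.monotone hij.le) (hFmem j)

/-- The index map of the layers of `σ`, as provided by `IsLayeredWith`. -/
structure IsLayerIndex {m k : ℕ} (σ : Equiv.Perm (Fin m)) (c : Fin m → Fin k) : Prop where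
  monotone : Monotone c
  anti : ∀ x y, c x = c y → x < y → σ y < σ x
  lt : ∀ x y, c x < c y → σ x < σ y

theorem IsLayerIndex.lt_iff {m k : ℕ} {σ : Equiv.Perm (Fin m)} {c : Fin m → Fin k}
    (hc : IsLayerIndex σ c) {i j : Fin m} (hij : i < j) : σ i < σ j ↔ c i ≠ c j :=
  ⟨fun h he => (hc.anti i j he hij).not_gt h,
    fun h => hc.lt i j (lt_of_le_of_ne (hc.monotone hij.le) h)⟩

theorem perm_lt_iff_of_forall_lt {m n : ℕ} {σ : Equiv.Perm (Fin m)} {π : Equiv.Perm (Fin n)}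
    {f : Fin m ↪o Fin n} (h : ∀ i j, i < j → (σ i < σ j ↔ π (f i) < π (f j))) (i j : Fin m) :
    σ i < σ j ↔ π (f i) < π (f j) := by
  rcases lt_trichotomy i j with hij | rfl | hij
  · exact h i j hij
  · simp
  · have := h j i hij
    have h1 : σ i ≠ σ j := fun e => hij.ne' (σ.injective e)
    have h2 : π (f i) ≠ π (f j) := fun e => hij.ne' (f.injective (π.injective e))
    rw [← not_le, ← not_le, not_iff_not, le_iff_lt_or_eq, le_iff_lt_or_eq, this]
    simp [h1.symm, h2.symm]

open Classical in
theorem card_sortedFit_le {m n k : ℕ} (hmn : m ≤ n) {σ : Equiv.Perm (Fin m)} {c : Fin m → Fin k}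
    (hc : IsLayerIndex σ c) {r : unitInterval → unitInterval → Prop} (hr : IsIntervalRel r)
    {x : Fin n → unitInterval} (hx : Function.Injective x) :
    ((Finset.univ.filter fun g : Fin m ↪ Fin n => x ∘ g ∈ sortedFit c r).card : ℝ) ≤
      n.choose m * maxPatternDensity σ n := by
  obtain ⟨τ, hτ⟩ := exists_strictMono_comp hx
  obtain ⟨π, hπ⟩ := hr.exists_perm hτ
  have hmax : patternDensity σ π ≤ maxPatternDensity σ n :=
    Finset.le_sup' (patternDensity σ) (Finset.mem_univ π)
  have hpos : (0 : ℝ) < n.choose m := by exact_mod_cast Nat.choose_pos hmn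
  refine le_trans ?_ (mul_le_mul_of_nonneg_left hmax hpos.le)
  rw [patternDensity, mul_div_cancel₀ _ hpos.ne', ← Fintype.card_coe, ← Nat.card_eq_fintype_card]
  have key : ∀ g : Fin m ↪ Fin n, x ∘ g ∈ sortedFit c r → StrictMono (τ.symm ∘ g) := by
    intro g hg i j hij
    rw [← hτ.lt_iff_lt]
    simpa using hg.1 hij
  refine Nat.cast_le.2 (Nat.card_le_card_of_injective
    (fun g => ⟨OrderEmbedding.ofStrictMono (τ.symm ∘ g.1) (key g.1 (Finset.mem_filter.1 g.2).2),
      perm_lt_iff_of_forall_lt fun i j hij => ?_⟩) ?_)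
  · have hg := (Finset.mem_filter.1 g.2).2
    refine (hc.lt_iff hij).trans (Iff.trans ?_ (hπ _ _ (key g.1 hg hij)).symm)
    simpa using (hg.2 i j).symm.not
  · intro g g' h
    refine Subtype.ext (DFunLike.ext _ _ fun i => ?_)
    have := congrArg (fun f => f.1 i) h
    simpa using this

-- Double counting over an n-point sample: each of the m! · C(n,m) embeddings fits with the same
-- probability, while for almost every sample at most C(n,m) times the maximum density of them fit.
open scoped Nat in
theorem factorial_mul_sortedFit_le_maxPatternDensity {m n k : ℕ} (hmn : m ≤ n)
    {σ : Equiv.Perm (Fin m)} {c : Fin m → Fin k}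
    (hc : IsLayerIndex σ c) {r : unitInterval → unitInterval → Prop} (hr : IsIntervalRel r)
    (μ : Measure unitInterval) [IsProbabilityMeasure μ] [NullSingletonClass μ] :
    m ! * (Measure.pi fun _ : Fin m => μ).real (sortedFit c r) ≤ maxPatternDensity σ n := by
  classical
  set ν := Measure.pi fun _ : Fin n => μ
  have hpos : (0 : ℝ) < n.choose m := by exact_mod_cast Nat.choose_pos hmn
  have hms := hr.measurableSet_sortedFit c
  have h1 : ∀ g : Fin m ↪ Fin n, MeasurableSet {x : Fin n → unitInterval | x ∘ g ∈ sortedFit c r} :=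
    fun g => (measurePreserving_comp_injective μ g.injective).measurable hms
  have hint : ∀ g : Fin m ↪ Fin n, Integrable
      ({x : Fin n → unitInterval | x ∘ g ∈ sortedFit c r}.indicator (fun _ => (1 : ℝ))) ν :=
    fun g => (integrable_const _).indicator (h1 g)
  have h2 : ∫ x, (∑ g : Fin m ↪ Fin n,
      {x : Fin n → unitInterval | x ∘ g ∈ sortedFit c r}.indicator (fun _ => (1 : ℝ)) x) ∂ν ≤
      ∫ _x, n.choose m * maxPatternDensity σ n ∂ν := by
    refine integral_mono_ae (integrable_finsetSum _ fun g _ => hint g) (integrable_const _) ?_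
    filter_upwards [ae_injective_pi μ] with x hx
    refine le_trans (le_of_eq ?_) (card_sortedFit_le hmn hc hr hx)
    simp [Set.indicator_apply, Finset.sum_boole]
  rw [integral_finsetSum _ fun g _ => hint g] at h2
  have h3 : ∀ g : Fin m ↪ Fin n, ∫ x, {x : Fin n → unitInterval | x ∘ g ∈ sortedFit c r}.indicator
      (fun _ => (1 : ℝ)) x ∂ν = (Measure.pi fun _ : Fin m => μ).real (sortedFit c r) := by
    intro g
    rw [integral_indicator_const _ (h1 g), smul_eq_mul, mul_one]
    exact (measurePreserving_comp_injective μ g.injective).measureReal_preimage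
      hms.nullMeasurableSet
  simp only [h3, Finset.sum_const, Finset.card_univ, Fintype.card_embedding_eq, Fintype.card_fin,
    nsmul_eq_mul, integral_const, probReal_univ, smul_eq_mul, one_mul] at h2
  rw [Nat.descFactorial_eq_factorial_mul_choose] at h2
  push_cast at h2
  refine le_of_mul_le_mul_left ?_ hpos
  linarith

open scoped Nat in
theorem IsPackingDensity.factorial_mul_sortedFit_le {m k : ℕ}
    {σ : Equiv.Perm (Fin m)} {δ : ℝ} (hδ : IsPackingDensity σ δ) {c : Fin m → Fin k}
    (hc : IsLayerIndex σ c) {r : unitInterval → unitInterval → Prop} (hr : IsIntervalRel r)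
    (μ : Measure unitInterval) [IsProbabilityMeasure μ] [NullSingletonClass μ] :
    m ! * (Measure.pi fun _ : Fin m => μ).real (sortedFit c r) ≤ δ :=
  ge_of_tendsto hδ ((eventually_ge_atTop m).mono fun _ hn =>
    factorial_mul_sortedFit_le_maxPatternDensity hn hc hr μ)

/-! ### Merging an interval into one class: gain and loss -/

/-- The relation obtained from `r` by making `B` a single class. -/
def mergeRel (r : unitInterval → unitInterval → Prop) (B : Set unitInterval)
    (u v : unitInterval) : Prop :=
  r u v ∨ (u ∈ B ∧ v ∈ B)

section Merge

variable {r : unitInterval → unitInterval → Prop} {B : Set unitInterval}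

theorem IsIntervalRel.merge (hr : IsIntervalRel r) (hB : B.OrdConnected)
    (hsat : ∀ u v, r u v → u ∈ B → v ∈ B) : IsIntervalRel (mergeRel r B) where
  equivalence := by
    refine ⟨fun u => .inl (hr.equivalence.refl u), ?_, ?_⟩
    · rintro u v (h | ⟨h, h'⟩)
      · exact .inl (hr.equivalence.symm h)
      · exact .inr ⟨h', h⟩
    · rintro u v w (h | ⟨hu, hv⟩) (h' | ⟨hv', hw⟩)
      · exact .inl (hr.equivalence.trans h h')
      · exact .inr ⟨hsat _ _ (hr.equivalence.symm h) hv', hw⟩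
      · exact .inr ⟨hu, hsat _ _ h' hv⟩
      · exact .inr ⟨hu, hw⟩
  convex := by
    rintro u v w huv hvw (h | ⟨hu, hw⟩)
    · exact .inl (hr.convex huv hvw h)
    · exact .inr ⟨hu, hB.out hu hw ⟨huv, hvw⟩⟩
  measurableSet := by
    have hBm := hB.measurableSet
    have : {p : unitInterval × unitInterval | mergeRel r B p.1 p.2} =
        {p | r p.1 p.2} ∪ B ×ˢ B := by
      ext p; rfl
    rw [this]
    exact hr.measurableSet.union (hBm.prod hBm)

variable {m k : ℕ} {c : Fin m → Fin k} {q : Fin k}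

/-- The tuples whose coordinates outside of block `q` are arranged around `B` in such a way that
block `q` could be completed by any points of `B`, if `B` were a class. -/
def outerFit (c : Fin m → Fin k) (r : unitInterval → unitInterval → Prop) (B : Set unitInterval)
    (q : Fin k) : Set (Fin m → unitInterval) :=
  {x | (∀ a b, c a ≠ q → c b ≠ q → (r (x a) (x b) ↔ c a = c b) ∧ (c a < c b → x a < x b)) ∧
    ∀ a, (c a < q → ∀ y ∈ B, x a < y) ∧ (q < c a → ∀ y ∈ B, y < x a)}

/-- The points of block `q` lie in `B` in any order, so the tuple has to be sorted first; this
permutes coordinates only within blocks. The unrelated pair in block `q` shows that the sorted tuple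
did not fit before the merge. -/
theorem exists_comp_perm_mem_sortedFit_merge (hsat : ∀ u v, r u v → u ∈ B → v ∈ B)
    (hr : IsIntervalRel r)
    (hc : Monotone c) {i₀ i₁ : Fin m} (h₀ : c i₀ = q) (h₁ : c i₁ = q) {x : Fin m → unitInterval}
    (hinj : Function.Injective x) (hxB : ∀ i, c i = q → x i ∈ B) (hne : ¬ r (x i₀) (x i₁))
    (hx : x ∈ outerFit c r B q) :
    ∃ τ : Equiv.Perm (Fin m), x ∘ τ ∈ sortedFit c (mergeRel r B) \ sortedFit c r := by
  obtain ⟨hx₁, hx₂⟩ := hx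
  have hlt : ∀ a b, c a < c b → x a < x b := by
    intro a b hab
    by_cases ha : c a = q
    · exact (hx₂ b).2 (ha ▸ hab) _ (hxB a ha)
    · by_cases hb : c b = q
      · exact (hx₂ a).1 (hb ▸ hab) _ (hxB b hb)
      · exact (hx₁ a b ha hb).2 hab
  have hout : ∀ a, c a ≠ q → x a ∉ B := by
    intro a ha hxa
    rcases lt_or_gt_of_ne ha with h | h
    · exact lt_irrefl _ ((hx₂ a).1 h _ hxa)
    · exact lt_irrefl _ ((hx₂ a).2 h _ hxa)
  have hiff : ∀ a b, mergeRel r B (x a) (x b) ↔ c a = c b := by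
    intro a b
    by_cases ha : c a = q
    · by_cases hb : c b = q
      · simp [mergeRel, hxB a ha, hxB b hb, ha, hb]
      · have : ¬ r (x a) (x b) := fun h => hout b hb (hsat _ _ h (hxB a ha))
        simp [mergeRel, this, hout b hb, ha, Ne.symm hb]
    · by_cases hb : c b = q
      · have : ¬ r (x a) (x b) :=
          fun h => hout a ha (hsat _ _ (hr.equivalence.symm h) (hxB b hb))
        simp [mergeRel, this, hout a ha, ha, hb]
      · simp [mergeRel, hout a ha, (hx₁ a b ha hb).1]
  obtain ⟨τ, hτ⟩ := exists_strictMono_comp hinj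
  have hcτ : c ∘ τ = c := by
    have hmono : Monotone (c ∘ τ) := by
      intro i j hij
      by_contra h
      exact (hlt _ _ (not_le.1 h)).not_ge (hτ.monotone hij)
    -- A finite sequence has only one monotone rearrangement.
    have := Tuple.unique_monotone (σ := τ) (τ := 1) hmono (by simpa using hc)
    simpa using this
  have hcτ' : ∀ i, c (τ i) = c i := congrFun hcτ
  refine ⟨τ, ⟨hτ, fun i j => ?_⟩, fun hmem => ?_⟩
  · rw [Function.comp, Function.comp, hiff, hcτ', hcτ']
  · have := (hmem.2 (τ.symm i₀) (τ.symm i₁)).2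
      (by rw [← hcτ' (τ.symm i₀), ← hcτ' (τ.symm i₁)]; simp [h₀, h₁])
    simp only [Function.comp, Equiv.apply_symm_apply] at this
    exact hne this

open scoped Nat in
/-- The gain in the density when `B` is made a single class. -/
theorem outerFit_mul_le (μ : Measure unitInterval) [IsProbabilityMeasure μ]
    [NullSingletonClass μ] (hB : B.OrdConnected) (hsat : ∀ u v, r u v → u ∈ B → v ∈ B)
    (hr : IsIntervalRel r) (hc : Monotone c) (hq : 2 ≤ (Finset.univ.filter fun i => c i = q).card) :
    (Measure.pi fun _ : Fin m => μ).real (outerFit c r B q) *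
      (μ.real B ^ ((Finset.univ.filter fun i => c i = q).card - 2) *
        (μ.prod μ).real ({p | ¬ r p.1 p.2} ∩ B ×ˢ B)) ≤
    m ! * (Measure.pi fun _ : Fin m => μ).real
      (sortedFit c (mergeRel r B) \ sortedFit c r) := by
  set ν := Measure.pi fun _ : Fin m => μ with hν
  set S := Finset.univ.filter fun i => c i = q with hS
  obtain ⟨i₀, h₀, i₁, h₁, hne⟩ := Finset.one_lt_card.1 hq
  have hmS : ∀ i, i ∈ S ↔ c i = q := by simp [hS]
  -- `outerFit` leaves block `q` unconstrained; seen as a condition on the other coordinates alone,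
  -- it is independent of that block.
  set V : Set ((Sᶜ : Finset (Fin m)) → unitInterval) :=
    {z | (∀ a b, (r (z a) (z b) ↔ c a = c b) ∧ (c a < c b → z a < z b)) ∧
      ∀ a : (Sᶜ : Finset (Fin m)), (c a < q → z a ∈ {u | ∀ y ∈ B, u < y}) ∧ (q < c a → z a ∈ {u | ∀ y ∈ B, y < u})}
    with hV
  have hVm : MeasurableSet V := by
    have hl : MeasurableSet {u : unitInterval | ∀ y ∈ B, u < y} :=
      Set.OrdConnected.measurableSet
        ⟨fun u hu v hv w hw y hy => hw.2.trans_lt (hv y hy)⟩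
    have hg : MeasurableSet {u : unitInterval | ∀ y ∈ B, y < u} :=
      Set.OrdConnected.measurableSet
        ⟨fun u hu v hv w hw y hy => (hu y hy).trans_le hw.1⟩
    refine measurableSet_setOfPred.2 (Measurable.and ?_ ?_)
    · exact Measurable.forall fun a => Measurable.forall fun b =>
        ((hr.measurable_eval (measurable_pi_apply a) (measurable_pi_apply b)).iff
          (by fun_prop)).and (Measurable.imp (by fun_prop) (measurableSet_setOfPred.1
            (measurableSet_lt (measurable_pi_apply a) (measurable_pi_apply b))))
    · exact Measurable.forall fun a => ((measurable_const).imp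
          (measurableSet_setOfPred.1 (measurable_pi_apply a hl))).and ((measurable_const).imp
          (measurableSet_setOfPred.1 (measurable_pi_apply a hg)))
  have hVo : {x : Fin m → unitInterval | (fun i : (Sᶜ : Finset (Fin m)) => x i) ∈ V} =
      outerFit c r B q := by
    ext x
    simp only [hV, outerFit, Set.mem_ofPred_eq, Subtype.forall, Finset.mem_compl, hmS]
    refine and_congr ⟨fun h a b ha hb => h a ha b hb, fun h a ha b hb => h a b ha hb⟩
      ⟨fun h a => ⟨fun ha => (h a ha.ne).1 ha, fun ha => (h a ha.ne').2 ha⟩,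
        fun h a _ => h a⟩
  have key := congrArg ENNReal.toReal
    (measure_pi_block μ S h₀ h₁ hne hB.measurableSet (A := {p | ¬ r p.1 p.2})
      hr.measurableSet.compl hVm)
  rw [hVo, ENNReal.toReal_mul, ENNReal.toReal_mul, ENNReal.toReal_pow] at key
  refine key.ge.trans ?_
  set G := sortedFit c (mergeRel r B) \ sortedFit c r with hG
  have hGm : MeasurableSet G := ((hr.merge hB hsat).measurableSet_sortedFit c).diff
    (hr.measurableSet_sortedFit c)
  have hsub : ν.real {x | (∀ i ∈ S, x i ∈ B) ∧ (x i₀, x i₁) ∈ {p | ¬ r p.1 p.2} ∧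
      (fun i : (Sᶜ : Finset (Fin m)) => x i) ∈ V} ≤
      ν.real (⋃ τ : Equiv.Perm (Fin m), (fun x => x ∘ τ) ⁻¹' G) := by
    refine ENNReal.toReal_mono (measure_ne_top _ _) (measure_mono_ae ?_)
    filter_upwards [ae_injective_pi μ] with x hx hmem
    obtain ⟨hb, hA, hxV⟩ := hmem
    have hxV' : x ∈ outerFit c r B q := hVo ▸ hxV
    exact Set.mem_iUnion.2 (exists_comp_perm_mem_sortedFit_merge hsat hr hc ((hmS _).1 h₀)
      ((hmS _).1 h₁) hx (fun i hi => hb i ((hmS i).2 hi)) hA hxV')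
  refine hsub.trans ((measureReal_iUnion_fintype_le _).trans (le_of_eq ?_))
  rw [Finset.sum_congr rfl fun (τ : Equiv.Perm (Fin m)) _ =>
    (measurePreserving_comp_injective μ τ.injective).measureReal_preimage hGm.nullMeasurableSet]
  simp [Fintype.card_perm, hν]

/-- A tuple that fits `r`, but no longer fits when `B` is made a single class, has two consecutive
blocks in `B`. -/
theorem exists_blocks_of_mem_sortedFit_diff (hB : B.OrdConnected)
    (hsat : ∀ u v, r u v → u ∈ B → v ∈ B) (hc : Monotone c)
    {x : Fin m → unitInterval} (hx : x ∈ sortedFit c r \ sortedFit c (mergeRel r B)) :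
    ∃ (d : ℕ) (hd : d + 1 < k), ∀ a, c a = ⟨d, by omega⟩ ∨ c a = ⟨d + 1, hd⟩ → x a ∈ B := by
  obtain ⟨⟨hmono, hfit⟩, hnot⟩ := hx
  have : ∃ i j, c i ≠ c j ∧ x i ∈ B ∧ x j ∈ B := by
    by_contra! h
    refine hnot ⟨hmono, fun i j => ?_⟩
    rw [mergeRel, hfit]
    refine ⟨?_, .inl⟩
    rintro (h' | ⟨h1, h2⟩)
    · exact h'
    · by_contra hne
      exact h i j hne h1 h2
  obtain ⟨i, j, hlt, hi, hj⟩ : ∃ i j, c i < c j ∧ x i ∈ B ∧ x j ∈ B := by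
    obtain ⟨i, j, hne, hi, hj⟩ := this
    rcases lt_or_gt_of_ne hne with h | h
    · exact ⟨i, j, h, hi, hj⟩
    · exact ⟨j, i, h, hj, hi⟩
  have hclt : ∀ {a b}, c a < c b → a < b := fun {a b} h => by
    by_contra h'
    exact (hc (not_lt.1 h')).not_gt h
  refine ⟨c i, by have := (c j).2; have : (c i : ℕ) < c j := hlt; omega, ?_⟩
  rintro a (ha | ha)
  · exact hsat _ _ ((hfit i a).2 ha.symm) hi
  · have hca : (c a : ℕ) = c i + 1 := by rw [ha]
    have hij : (c i : ℕ) < c j := hlt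
    by_cases haj : c a = c j
    · exact hsat _ _ ((hfit j a).2 haj.symm) hj
    · have h1 : c i < c a := by rw [Fin.lt_def]; omega
      have h2 : c a < c j := by
        rw [Fin.lt_def]
        have : (c a : ℕ) ≠ c j := fun h => haj (Fin.ext h)
        omega
      exact hB.out hi hj ⟨(hmono (hclt h1)).le, (hmono (hclt h2)).le⟩

/-- The loss in the density when `B` is made a single class. -/
theorem sortedFit_diff_le (μ : Measure unitInterval) [IsProbabilityMeasure μ]
    (hB : B.OrdConnected) (hsat : ∀ u v, r u v → u ∈ B → v ∈ B)
    (hr : IsIntervalRel r) (hc : Monotone c) (hsurj : Function.Surjective c) {e : ℕ}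
    (he : ∀ (d : ℕ) (hd : d + 1 < k), e ≤ (Finset.univ.filter fun i => c i = ⟨d, by omega⟩).card +
      (Finset.univ.filter fun i => c i = ⟨d + 1, hd⟩).card) :
    (Measure.pi fun _ : Fin m => μ).real (sortedFit c r \ sortedFit c (mergeRel r B)) ≤
      k * (μ.real B ^ (e - 2) * (μ.prod μ).real ({p | ¬ r p.1 p.2} ∩ B ×ˢ B)) := by
  set ν := Measure.pi fun _ : Fin m => μ with hν
  -- Fitting `r` is kept in `Q d`: it makes points of the two blocks unrelated, which yields the
  -- same pair factor as in the gain.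
  set Q : Fin k → Set (Fin m → unitInterval) := fun d =>
    {x | x ∈ sortedFit c r ∧ ∃ hd : (d : ℕ) + 1 < k, ∀ a, c a = d ∨ c a = ⟨d + 1, hd⟩ → x a ∈ B}
    with hQ
  have hsub : sortedFit c r \ sortedFit c (mergeRel r B) ⊆ ⋃ d, Q d := by
    intro x hx
    obtain ⟨d, hd, h⟩ := exists_blocks_of_mem_sortedFit_diff hB hsat hc hx
    exact Set.mem_iUnion.2 ⟨⟨d, by omega⟩, hx.1, hd, h⟩
  refine (measureReal_mono hsub).trans ((measureReal_iUnion_fintype_le _).trans ?_)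
  have hle : ∀ d, ν.real (Q d) ≤
      μ.real B ^ (e - 2) * (μ.prod μ).real ({p | ¬ r p.1 p.2} ∩ B ×ˢ B) := by
    intro d
    by_cases hd : (d : ℕ) + 1 < k
    swap
    · have : Q d = ∅ := by
        ext x; simp [hQ, hd]
      rw [this, measureReal_empty]
      positivity
    set S := Finset.univ.filter fun a => c a = d ∨ c a = ⟨d + 1, hd⟩ with hS
    obtain ⟨i₀, h₀⟩ := hsurj d
    obtain ⟨i₁, h₁⟩ := hsurj ⟨d + 1, hd⟩
    have hcne : c i₀ ≠ c i₁ := by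
      rw [h₀, h₁]; intro h; have := congrArg Fin.val h; simp at this
    have hne : i₀ ≠ i₁ := fun h => hcne (h ▸ rfl)
    have key := congrArg ENNReal.toReal
      (measure_pi_block μ S (i₀ := i₀) (i₁ := i₁) (by simp [hS, h₀]) (by simp [hS, h₁]) hne
        hB.measurableSet (A := {p | ¬ r p.1 p.2}) hr.measurableSet.compl (V := Set.univ)
        MeasurableSet.univ)
    rw [ENNReal.toReal_mul, ENNReal.toReal_mul, ENNReal.toReal_pow] at key
    have hcard : e ≤ S.card := by
      have : S = (Finset.univ.filter fun i => c i = d) ∪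
          (Finset.univ.filter fun i => c i = ⟨d + 1, hd⟩) := by
        ext; simp [hS]
      rw [this, Finset.card_union_of_disjoint]
      · exact he d hd
      · rw [Finset.disjoint_left]
        intro a ha ha'
        simp only [Finset.mem_filter, Finset.mem_univ, true_and] at ha ha'
        have := congrArg Fin.val (ha.symm.trans ha')
        simp at this
    calc ν.real (Q d) ≤ _ := measureReal_mono (fun x hx => ?_)
      _ = _ := key
      _ ≤ _ := ?_
    · obtain ⟨hx, _, h⟩ := hx
      exact ⟨fun i hi => h i (by simpa [hS] using hi), fun h => hcne ((hx.2 _ _).1 h), trivial⟩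
    · simp only [Set.mem_univ, Set.ofPred_true, measure_univ, ENNReal.toReal_one, one_mul]
      exact mul_le_mul_of_nonneg_right (pow_le_pow_of_le_one measureReal_nonneg
        measureReal_le_one (by omega)) ENNReal.toReal_nonneg
  refine (Finset.sum_le_sum fun d _ => hle d).trans (le_of_eq ?_)
  simp

end Merge

/-! ### Layered permutons and their relation -/

/-- Two points are related if they are equal or interior points of the same member of `J`. -/
def layerRel (J : Set (NonemptyInterval unitInterval)) (u v : unitInterval) : Prop :=
  u = v ∨ ∃ K ∈ J, u ∈ Set.Ioo K.fst K.snd ∧ v ∈ Set.Ioo K.fst K.snd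

namespace Permuton

/-- The uniform marginal of a permuton. -/
noncomputable def marginal (P : Permuton) : Measure unitInterval :=
  P.toMeasure.map Prod.fst

instance (P : Permuton) : IsProbabilityMeasure P.toMeasure := P.isProbabilityMeasure

instance (P : Permuton) : IsProbabilityMeasure P.marginal :=
  Measure.isProbabilityMeasure_map measurable_fst.aemeasurable

theorem marginal_Icc (P : Permuton) {a b : unitInterval} (hab : a ≤ b) :
    P.marginal (Set.Icc a b) = ENNReal.ofReal ((b : ℝ) - a) := by
  rw [marginal, Measure.map_apply measurable_fst measurableSet_Icc, ← P.fst_marginal a b hab]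
  congr 1
  ext p; simp

instance (P : Permuton) : NullSingletonClass P.marginal where
  measure_singleton x := by
    rw [← Set.Icc_self, P.marginal_Icc le_rfl]; simp

theorem marginal_real_Ioo (P : Permuton) {a b : unitInterval} (hab : a ≤ b) :
    P.marginal.real (Set.Ioo a b) = b - a := by
  rw [measureReal_congr Ioo_ae_eq_Icc, Measure.real, P.marginal_Icc hab,
    ENNReal.toReal_ofReal (sub_nonneg.2 hab)]

namespace HasLayers

variable {P : Permuton} {J : Set (NonemptyInterval unitInterval)}

theorem eq_of_mem (hJ : P.HasLayers J) {K L : NonemptyInterval unitInterval} (hK : K ∈ J)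
    (hL : L ∈ J) {u : unitInterval} (hu : u ∈ Set.Ioo K.fst K.snd)
    (hu' : u ∈ Set.Icc L.fst L.snd) : K = L := by
  by_contra h
  exact Set.disjoint_left.1 (hJ.internally_disjoint hK hL h) hu hu'

theorem isIntervalRel (hJ : P.HasLayers J) : IsIntervalRel (layerRel J) where
  equivalence := by
    refine ⟨fun u => .inl rfl, ?_, ?_⟩
    · rintro u v (h | ⟨K, hK, h, h'⟩)
      · exact .inl h.symm
      · exact .inr ⟨K, hK, h', h⟩
    · rintro u v w (rfl | ⟨K, hK, hu, hv⟩) (rfl | ⟨L, hL, hv', hw⟩)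
      · exact .inl rfl
      · exact .inr ⟨L, hL, hv', hw⟩
      · exact .inr ⟨K, hK, hu, hv⟩
      · obtain rfl := hJ.eq_of_mem hK hL hv (Set.Ioo_subset_Icc_self hv')
        exact .inr ⟨K, hK, hu, hw⟩
  convex := by
    rintro u v w huv hvw (rfl | ⟨K, hK, hu, hw⟩)
    · exact .inl (le_antisymm huv hvw)
    · exact .inr ⟨K, hK, hu, hu.1.trans_le huv, hvw.trans_lt hw.2⟩
  measurableSet := by
    have : {p : unitInterval × unitInterval | layerRel J p.1 p.2} = Set.diagonal unitInterval ∪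
        ⋃ K ∈ J, Set.Ioo K.fst K.snd ×ˢ Set.Ioo K.fst K.snd := by
      ext p
      simp only [layerRel, Set.mem_ofPred_eq, Set.mem_union, Set.mem_diagonal_iff, Set.mem_iUnion,
        Set.mem_prod, exists_prop]
    rw [this]
    exact measurableSet_diagonal.union
      (isOpen_biUnion fun K _ => isOpen_Ioo.prod isOpen_Ioo).measurableSet

theorem snd_le_fst (hJ : P.HasLayers J) {K L : NonemptyInterval unitInterval} (hK : K ∈ J)
    (hL : L ∈ J) (hKL : K ≠ L) {u v : unitInterval} (hu : u ∈ Set.Icc K.fst K.snd)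
    (hu' : K.fst < K.snd → u ∈ Set.Ioo K.fst K.snd) (hv : v ∈ Set.Icc L.fst L.snd) (huv : u < v) :
    K.snd ≤ L.fst := by
  by_contra! h
  rcases K.fst_le_snd.lt_or_eq with hlt | heq
  · have hu'' := hu' hlt
    rcases le_or_gt L.fst u with h1 | h1
    · exact hKL (hJ.eq_of_mem hK hL hu'' ⟨h1, huv.le.trans hv.2⟩)
    · exact hKL (hJ.eq_of_mem hK hL ⟨hu''.1.trans h1, h⟩ ⟨le_rfl, L.fst_le_snd⟩)
  · have hsu : K.snd = u := le_antisymm (heq ▸ hu.1) hu.2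
    exact hKL (hJ.eq_of_mem hL hK (u := u) ⟨hsu ▸ h, huv.trans_le hv.2⟩ hu).symm

theorem mem_sortedFit (hJ : P.HasLayers J) {m k : ℕ} {σ : Equiv.Perm (Fin m)} {c : Fin m → Fin k}
    (hc : IsLayerIndex σ c) {p : Fin m → unitInterval × unitInterval}
    (hmono : StrictMono fun i => (p i).1) (hσ : ∀ i j, σ i < σ j ↔ (p i).2 < (p j).2)
    (hsupp : ∀ i, p i ∈ P.toMeasure.support)
    (hend : ∀ i, ∀ K ∈ J, K.fst < K.snd → (p i).1 ≠ K.fst ∧ (p i).1 ≠ K.snd) :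
    (fun i => (p i).1) ∈ sortedFit c (layerRel J) := by
  refine ⟨hmono, ?_⟩
  have key : ∀ i j, i < j → (layerRel J (p i).1 (p j).1 ↔ c i = c j) := by
    intro i j hij
    have hx : (p i).1 < (p j).1 := hmono hij
    have hmem := fun i => hJ.support_eq ▸ hsupp i
    obtain ⟨K, hK, hiK, hyi⟩ := hmem i
    obtain ⟨L, hL, hjL, hyj⟩ := hmem j
    have hIoo : ∀ {i K}, K ∈ J → (p i).1 ∈ Set.Icc K.fst K.snd → K.fst < K.snd →
        (p i).1 ∈ Set.Ioo K.fst K.snd := fun {i K} hK h hlt =>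
      ⟨lt_of_le_of_ne h.1 (hend i K hK hlt).1.symm, lt_of_le_of_ne h.2 (hend i K hK hlt).2⟩
    rw [← not_iff_not, ← ne_eq (c i), ← hc.lt_iff hij, hσ]
    constructor
    · intro hnot
      have hKL : K ≠ L := by
        rintro rfl
        have hlt : K.fst < K.snd := hiK.1.trans_lt (hx.trans_le hjL.2)
        exact hnot (.inr ⟨K, hK, hIoo hK hiK hlt, hIoo hK hjL hlt⟩)
      have hle : (K.snd : ℝ) ≤ L.fst := hJ.snd_le_fst hK hL hKL hiK (hIoo hK hiK) hjL hx
      have h1 : (K.fst : ℝ) ≤ (p i).1 := hiK.1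
      have h2 : ((p j).1 : ℝ) ≤ L.snd := hjL.2
      have hy : (p i).2 ≤ (p j).2 := by
        rw [← Subtype.coe_le_coe]; linarith
      -- Equal heights would make neither of `σ i`, `σ j` smaller than the other.
      refine lt_of_le_of_ne hy fun heq => hij.ne (σ.injective ?_)
      refine le_antisymm (not_lt.1 ?_) (not_lt.1 ?_) <;> rw [hσ, heq] <;> exact lt_irrefl _
    · rintro hlt (h | ⟨M, hM, hiM, hjM⟩)
      · exact hx.ne h
      · obtain rfl := hJ.eq_of_mem hM hK hiM hiK
        obtain rfl := hJ.eq_of_mem hM hL hjM hjL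
        have h1 : ((p i).2 : ℝ) < (p j).2 := hlt
        have h2 : ((p i).1 : ℝ) < (p j).1 := hx
        linarith
  intro i j
  rcases lt_trichotomy i j with h | rfl | h
  · exact key i j h
  · simp [layerRel]
  · rw [eq_comm (a := c i), ← key j i h]
    exact ⟨hJ.isIntervalRel.equivalence.symm, hJ.isIntervalRel.equivalence.symm⟩

theorem countable_nondegenerate (hJ : P.HasLayers J) : {K ∈ J | K.fst < K.snd}.Countable := by
  refine Set.PairwiseDisjoint.countable_of_isOpen
    (s := fun K : NonemptyInterval unitInterval => Set.Ioo K.fst K.snd) ?_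
    (fun K _ => isOpen_Ioo) (fun K hK => Set.nonempty_Ioo.2 hK.2)
  intro K hK L hL hKL
  exact (hJ.internally_disjoint hK.1 hL.1 hKL).mono_right Set.Ioo_subset_Icc_self

theorem ae_ne_endpoints (hJ : P.HasLayers J) :
    ∀ᵐ u ∂P.marginal, ∀ K ∈ J, K.fst < K.snd → u ≠ K.fst ∧ u ≠ K.snd := by
  have h : ∀ᵐ u ∂P.marginal, ∀ K ∈ {K ∈ J | K.fst < K.snd}, u ≠ K.fst ∧ u ≠ K.snd := by
    refine (ae_ball_iff hJ.countable_nondegenerate).2 fun K _ => ?_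
    have h1 : ∀ a : unitInterval, ∀ᵐ u ∂P.marginal, u ≠ a := fun a => by simp [ae_iff]
    exact (h1 _).and (h1 _)
  filter_upwards [h] with u hu K hK hlt using hu K ⟨hK, hlt⟩

-- Almost every sample lies on the support and avoids the countably many endpoints of nondegenerate
-- layers. The factor m! counts the sorting permutations.
open scoped Nat in
theorem density_le (hJ : P.HasLayers J) {m k : ℕ} {σ : Equiv.Perm (Fin m)} {c : Fin m → Fin k}
    (hc : IsLayerIndex σ c) :
    P.density σ ≤ m ! * (Measure.pi fun _ : Fin m => P.marginal).real
      (sortedFit c (layerRel J)) := by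
  set ν := Measure.pi fun _ : Fin m => P.toMeasure with hν
  have hms := hJ.isIntervalRel.measurableSet_sortedFit c
  have hfst : MeasurePreserving (fun (p : Fin m → unitInterval × unitInterval) i => (p i).1) ν
      (Measure.pi fun _ => P.marginal) :=
    measurePreserving_pi (fun _ => P.toMeasure) (fun _ => P.marginal)
      fun _ => ⟨measurable_fst, rfl⟩
  have hcoord : ∀ {Q : unitInterval × unitInterval → Prop}, (∀ᵐ z ∂P.toMeasure, Q z) →
      ∀ᵐ p ∂ν, ∀ i, Q (p i) := fun {Q} hQ => ae_all_iff.2 fun i =>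
    (measurePreserving_eval (fun _ : Fin m => P.toMeasure) i).quasiMeasurePreserving.ae hQ
  have hsupp := hcoord (Q := (· ∈ P.toMeasure.support)) Measure.support_mem_ae
  have hend := hcoord (ae_of_ae_map measurable_fst.aemeasurable hJ.ae_ne_endpoints)
  set D := (fun (p : Fin m → unitInterval × unitInterval) i => (p i).1) ⁻¹'
    sortedFit c (layerRel J) with hD
  have hDm : MeasurableSet D := hfst.measurable hms
  have hsub : ν.real {p | PointsInduce σ p} ≤
      ν.real (⋃ τ : Equiv.Perm (Fin m), (fun p => p ∘ τ) ⁻¹' D) := by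
    refine ENNReal.toReal_mono (measure_ne_top _ _) (measure_mono_ae ?_)
    filter_upwards [hsupp, hend] with p hp₁ hp₂ hp
    obtain ⟨τ, hτ, hτ'⟩ := hp
    exact Set.mem_iUnion.2 ⟨τ, hJ.mem_sortedFit hc (p := p ∘ τ) hτ hτ' (fun i => hp₁ _)
      (fun i => hp₂ _)⟩
  refine hsub.trans ((measureReal_iUnion_fintype_le _).trans (le_of_eq ?_))
  rw [Finset.sum_congr rfl fun (τ : Equiv.Perm (Fin m)) _ =>
    (measurePreserving_comp_injective P.toMeasure τ.injective).measureReal_preimage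
      hDm.nullMeasurableSet, hD, hfst.measureReal_preimage hms.nullMeasurableSet]
  simp [Fintype.card_perm]

end HasLayers

/-- Cut [0,1] into m equal intervals and join those whose indices lie in the same block; tuples with
one point inside each interval fit. -/
theorem exists_sortedFit_pos (P : Permuton) {m k : ℕ} {c : Fin m → Fin k} (hc : Monotone c) :
    ∃ r, IsIntervalRel r ∧
      0 < (Measure.pi fun _ : Fin m => P.marginal).real (sortedFit c r) := by
  rcases Nat.eq_zero_or_pos m with rfl | hm
  · refine ⟨fun _ _ => True, ⟨⟨fun _ => trivial, fun _ => trivial, fun _ _ => trivial⟩,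
      fun _ _ _ _ _ _ => trivial, by simp⟩, ?_⟩
    have : sortedFit c (fun _ _ => True) = Set.univ :=
      Set.eq_univ_of_forall fun x => ⟨fun i => i.elim0, fun i => i.elim0⟩
    rw [this]; simp
  have hm' : (0 : ℝ) < m := by exact_mod_cast hm
  -- The minimum matters only at `u = 1`, where the floor is `m`.
  let f : unitInterval → Fin k := fun u => c ⟨min ⌊(m : ℝ) * u⌋₊ (m - 1), by omega⟩
  have hf : Monotone f := fun u v huv => hc (by
    rw [Fin.mk_le_mk]
    exact min_le_min_right _ (Nat.floor_mono (mul_le_mul_of_nonneg_left huv hm'.le)))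
  refine ⟨fun u v => f u = f v, ⟨⟨fun _ => rfl, fun h => h.symm, fun h h' => h.trans h'⟩,
    fun u v w huv hvw h => le_antisymm (hf huv) ((hf hvw).trans h.ge), ?_⟩, ?_⟩
  · have hfm : Measurable f := measurable_to_countable' fun d =>
      Set.OrdConnected.measurableSet ⟨fun u hu v hv w hw =>
        le_antisymm ((hf hw.2).trans (le_of_eq hv)) ((le_of_eq (Eq.symm hu)).trans (hf hw.1))⟩
    exact measurableSet_eq_fun (hfm.comp measurable_fst) (hfm.comp measurable_snd)
  let a : ℕ → unitInterval := fun i => Set.projIcc 0 1 zero_le_one ((i : ℝ) / m)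
  have ha : ∀ i : ℕ, i ≤ m → (a i : ℝ) = i / m := fun i hi => by
    have h1 : (i : ℝ) / m ≤ 1 := (div_le_one hm').2 (by exact_mod_cast hi)
    have h2 : 0 ≤ (i : ℝ) / m := by positivity
    simp [a, Set.coe_projIcc, h1, h2]
  have hbox : (Set.univ.pi fun i : Fin m => Set.Ioo (a i) (a (i + 1))) ⊆
      sortedFit c fun u v => f u = f v := by
    intro x hx
    have hx1 : ∀ i : Fin m, (i : ℝ) < m * x i := fun i => by
      have h : (a i : ℝ) < x i := (hx i trivial).1
      rw [ha _ i.2.le, div_lt_iff₀ hm'] at h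
      linarith
    have hx2 : ∀ i : Fin m, (m : ℝ) * x i < i + 1 := fun i => by
      have h : (x i : ℝ) < a (i + 1) := (hx i trivial).2
      rw [ha _ i.2, lt_div_iff₀ hm'] at h
      push_cast at h
      linarith
    have hfx : ∀ i, f (x i) = c i := fun i => by
      have : ⌊(m : ℝ) * x i⌋₊ = i :=
        (Nat.floor_eq_iff (mul_nonneg hm'.le (x i).2.1)).2 ⟨(hx1 i).le, hx2 i⟩
      simp only [f, this]
      congr 1
      apply Fin.ext
      simp only
      omega
    refine ⟨fun i j hij => ?_, fun i j => by simp only [hfx]⟩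
    have h1 : (i : ℝ) + 1 ≤ j := by exact_mod_cast hij
    rw [← Subtype.coe_lt_coe]
    exact lt_of_mul_lt_mul_left (((hx2 i).trans_le h1).trans (hx1 j)) hm'.le
  refine lt_of_lt_of_le ?_ (measureReal_mono hbox)
  rw [Measure.real, Measure.pi_pi, ENNReal.toReal_prod]
  refine Finset.prod_pos fun i _ => ?_
  have hlt : (a i : ℝ) < a (i + 1) := by
    rw [ha _ i.2.le, ha _ i.2]
    push_cast
    exact div_lt_div_of_pos_right (by linarith) hm'
  have := P.marginal_real_Ioo (a := a i) (b := a (i + 1)) hlt.le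
  rw [Measure.real] at this
  rw [this]
  linarith

end Permuton

/-! ### Intervals on which the relation is equality -/

section Trivial

variable {m k : ℕ} {c : Fin m → Fin k} {r : unitInterval → unitInterval → Prop}

/-- If `r` is trivial on `B` and there are no consecutive singleton blocks, then nothing is lost
when `B` is made a single class. -/
theorem sortedFit_subset_of_trivial {B : Set unitInterval} (hB : B.OrdConnected)
    (htriv : ∀ u ∈ B, ∀ v, r u v → u = v) (hc : Monotone c)
    (he : ∀ (d : ℕ) (hd : d + 1 < k), 3 ≤ (Finset.univ.filter fun i => c i = ⟨d, by omega⟩).card +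
      (Finset.univ.filter fun i => c i = ⟨d + 1, hd⟩).card) :
    sortedFit c r ⊆ sortedFit c (mergeRel r B) := by
  intro x hx
  by_contra hnot
  obtain ⟨d, hd, h⟩ := exists_blocks_of_mem_sortedFit_diff hB
    (fun u v huv hu => htriv u hu v huv ▸ hu) hc ⟨hx, hnot⟩
  have hle : ∀ e : Fin k, (∀ a, c a = e → x a ∈ B) →
      (Finset.univ.filter fun i => c i = e).card ≤ 1 := by
    intro e he
    refine Finset.card_le_one.2 fun i hi j hj => ?_
    simp only [Finset.mem_filter, Finset.mem_univ, true_and] at hi hj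
    exact hx.1.injective (htriv _ (he i hi) _ ((hx.2 i j).2 (hi.trans hj.symm)))
  have h1 := hle _ fun a ha => h a (.inl ha)
  have h2 := hle _ fun a ha => h a (.inr ha)
  have := he d hd
  omega

/-- A tuple without points between `a` and `b` has a block of size at least two that can be moved
there. -/
theorem exists_mem_outerFit (hk : 0 < k) (hc : Monotone c)
    (hfirst : 2 ≤ (Finset.univ.filter fun i => c i = ⟨0, hk⟩).card)
    (hlast : 2 ≤ (Finset.univ.filter fun i => c i = ⟨k - 1, by omega⟩).card)
    (he : ∀ (d : ℕ) (hd : d + 1 < k), 3 ≤ (Finset.univ.filter fun i => c i = ⟨d, by omega⟩).card +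
      (Finset.univ.filter fun i => c i = ⟨d + 1, hd⟩).card)
    {x : Fin m → unitInterval} (hx : x ∈ sortedFit c r) {a b : unitInterval}
    (hab : ∀ i, x i ≤ a ∨ b ≤ x i) :
    ∃ q, 2 ≤ (Finset.univ.filter fun i => c i = q).card ∧ x ∈ outerFit c r (Set.Ioo a b) q := by
  have hclt : ∀ {i j}, c i < c j → i < j := fun {i j} h => by
    by_contra h'
    exact (hc (not_lt.1 h')).not_gt h
  suffices h : ∃ q, 2 ≤ (Finset.univ.filter fun i => c i = q).card ∧
      ∀ i, (c i < q → x i ≤ a) ∧ (q < c i → b ≤ x i) by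
    obtain ⟨q, hq, h⟩ := h
    exact ⟨q, hq, fun i j _ _ => ⟨hx.2 i j, fun hij => hx.1 (hclt hij)⟩,
      fun i => ⟨fun hi y hy => ((h i).1 hi).trans_lt hy.1,
        fun hi y hy => hy.2.trans_le ((h i).2 hi)⟩⟩
  by_cases hT : (Finset.univ.filter fun i => x i ≤ a).Nonempty
  -- Take the block of the last point at or before `a`. If it is a singleton, it is not the last
  -- block, and the next one has size at least two.
  · set i₁ := (Finset.univ.filter fun i => x i ≤ a).max' hT with hi₁
    have hmem : x i₁ ≤ a := by
      have := Finset.max'_mem _ hT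
      simpa using this
    have hgt : ∀ i, c i₁ < c i → b ≤ x i := by
      intro i hi
      refine (hab i).resolve_left fun h => (hclt hi).not_ge ?_
      exact Finset.le_max' _ _ (by simpa using h)
    have hlt : ∀ i, c i < c i₁ → x i ≤ a := fun i hi => (hx.1 (hclt hi)).le.trans hmem
    by_cases hcard : 2 ≤ (Finset.univ.filter fun i => c i = c i₁).card
    · exact ⟨c i₁, hcard, fun i => ⟨hlt i, hgt i⟩⟩
    · have hd : (c i₁ : ℕ) + 1 < k := by
        by_contra hd
        refine hcard ?_
        have : c i₁ = ⟨k - 1, by omega⟩ := Fin.ext (by simp only; omega)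
        rw [this]; exact hlast
      have h3 := he _ hd
      refine ⟨⟨c i₁ + 1, hd⟩, by simp only [Fin.eta] at h3; omega,
        fun i => ⟨fun hi => ?_, fun hi => hgt i ?_⟩⟩
      · have hle : (c i : ℕ) < c i₁ + 1 := hi
        rcases (show (c i : ℕ) ≤ c i₁ by omega).lt_or_eq with h | h
        · exact hlt i h
        · have : i = i₁ := Finset.card_le_one.1 (Nat.lt_succ_iff.1 (not_le.1 hcard)) i
            (by simpa using Fin.ext h) i₁ (by simp)
          exact this ▸ hmem
      · have hle : (c i₁ : ℕ) + 1 < c i := hi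
        rw [Fin.lt_def]; omega
  · refine ⟨⟨0, hk⟩, hfirst, fun i => ⟨fun hi => absurd hi (by simp [Fin.lt_def]),
      fun _ => (hab i).resolve_left fun h => hT ⟨i, by simpa using h⟩⟩⟩

end Trivial

/-- Two steps are needed because the right end of layer n + 1 is controlled only by the left end of
layer n + 2. -/
theorem exists_sub_lt_of_monotone {a : ℕ → ℝ} (ha : Monotone a) (hb : BddAbove (Set.range a))
    {ε : ℝ} (hε : 0 < ε) (N : ℕ) : ∃ n ≥ N, a (n + 2) - a n < ε := by
  have h := tendsto_atTop_ciSup ha hb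
  have h2 := (h.comp (tendsto_add_atTop_nat 2)).sub h
  rw [sub_self] at h2
  obtain ⟨n, hn, hnN⟩ := ((h2.eventually_lt_const hε).and (eventually_ge_atTop N)).exists
  exact ⟨n, hnN, hn⟩

/-! ### Optimality and finiteness -/

namespace Permuton.HasLayers

open scoped Nat

variable {P : Permuton} {J : Set (NonemptyInterval unitInterval)} {m k : ℕ}
  {σ : Equiv.Perm (Fin m)} {c : Fin m → Fin k}

theorem gain_le_loss (hJ : P.HasLayers J) (hopt : P.IsOptimal σ) (hc : IsLayerIndex σ c)
    {B : Set unitInterval} (hB : B.OrdConnected) (hsat : ∀ u v, layerRel J u v → u ∈ B → v ∈ B) :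
    (Measure.pi fun _ : Fin m => P.marginal).real
      (sortedFit c (mergeRel (layerRel J) B) \ sortedFit c (layerRel J)) ≤
    (Measure.pi fun _ : Fin m => P.marginal).real
      (sortedFit c (layerRel J) \ sortedFit c (mergeRel (layerRel J) B)) := by
  set ν := Measure.pi fun _ : Fin m => P.marginal
  have hr := hJ.isIntervalRel
  have hr' := hr.merge hB hsat
  have h1 := (hopt.factorial_mul_sortedFit_le hc hr' P.marginal).trans (hJ.density_le hc)
  have h2 := le_of_mul_le_mul_left h1 (by positivity)
  have h3 := measureReal_inter_add_sdiff (μ := ν) (s := sortedFit c (layerRel J))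
    (hr'.measurableSet_sortedFit c)
  have h4 := measureReal_inter_add_sdiff (μ := ν) (s := sortedFit c (mergeRel (layerRel J) B))
    (hr.measurableSet_sortedFit c)
  rw [Set.inter_comm] at h4
  linarith

theorem sortedFit_pos (hJ : P.HasLayers J) (hopt : P.IsOptimal σ) (hc : IsLayerIndex σ c) :
    0 < (Measure.pi fun _ : Fin m => P.marginal).real (sortedFit c (layerRel J)) := by
  obtain ⟨r, hr, hpos⟩ := P.exists_sortedFit_pos hc.monotone
  have h1 := (hopt.factorial_mul_sortedFit_le hc hr P.marginal).trans (hJ.density_le hc)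
  exact hpos.trans_le (le_of_mul_le_mul_left h1 (by positivity))

theorem not_layerRel (hJ : P.HasLayers J) {K L : NonemptyInterval unitInterval} (hK : K ∈ J)
    (hL : L ∈ J) (hKL : K.snd ≤ L.fst) {u v : unitInterval} (hu : u ∈ Set.Ioo K.fst K.snd)
    (hv : v ∈ Set.Ioo L.fst L.snd) : ¬ layerRel J u v := by
  have huv : u < v := hu.2.trans (hKL.trans_lt hv.1)
  rintro (rfl | ⟨M, hM, huM, hvM⟩)
  · exact huv.false
  · obtain rfl := hJ.eq_of_mem hM hK huM (Set.Ioo_subset_Icc_self hu)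
    obtain rfl := hJ.eq_of_mem hM hL hvM (Set.Ioo_subset_Icc_self hv)
    exact (hu.2.trans (hKL.trans_lt hu.1)).false

/-- A layer reaching across `K.fst` or `L.snd` would contain an endpoint of `K` or `L` in its
interior. -/
theorem saturated_Ioo (hJ : P.HasLayers J) {K L : NonemptyInterval unitInterval} (hK : K ∈ J)
    (hL : L ∈ J) (u v : unitInterval) (huv : layerRel J u v) (hu : u ∈ Set.Ioo K.fst L.snd) :
    v ∈ Set.Ioo K.fst L.snd := by
  obtain rfl | ⟨M, hM, huM, hvM⟩ := huv
  · exact hu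
  · constructor
    · by_contra! h
      obtain rfl := hJ.eq_of_mem hM hK (u := K.fst) ⟨hvM.1.trans_le h, hu.1.trans huM.2⟩
        ⟨le_rfl, K.fst_le_snd⟩
      exact (hvM.1.trans_le h).false
    · by_contra! h
      obtain rfl := hJ.eq_of_mem hM hL (u := L.snd) ⟨huM.1.trans hu.2, h.trans_lt hvM.2⟩
        ⟨L.fst_le_snd, le_rfl⟩
      exact (h.trans_lt hvM.2).false

theorem prod_marginal_pos {s : Set (unitInterval × unitInterval)} {a b a' b' : unitInterval}
    (hab : a < b) (hab' : a' < b') (hs : Set.Ioo a b ×ˢ Set.Ioo a' b' ⊆ s) :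
    0 < (P.marginal.prod P.marginal).real s := by
  refine lt_of_lt_of_le ?_ (measureReal_mono hs)
  rw [measureReal_prod_prod, P.marginal_real_Ioo hab.le, P.marginal_real_Ioo hab'.le]
  exact mul_pos (sub_pos.2 hab) (sub_pos.2 hab')

/-- Merging two nondegenerate layers of an optimal permuton which are close to each other, and all
that is between them, is impossible if this leaves enough room for the other blocks. -/
theorem le_of_outerFit (hJ : P.HasLayers J) (hopt : P.IsOptimal σ) (hc : IsLayerIndex σ c)
    (hsurj : Function.Surjective c) {q : Fin k}
    (hq : 2 ≤ (Finset.univ.filter fun i => c i = q).card)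
    (he : ∀ (d : ℕ) (hd : d + 1 < k), (Finset.univ.filter fun i => c i = q).card + 1 ≤
      (Finset.univ.filter fun i => c i = ⟨d, by omega⟩).card +
      (Finset.univ.filter fun i => c i = ⟨d + 1, hd⟩).card)
    {K L : NonemptyInterval unitInterval} (hK : K ∈ J) (hL : L ∈ J) (hK' : K.fst < K.snd)
    (hL' : L.fst < L.snd) (hKL : K.snd ≤ L.fst) {w : ℝ}
    (hw : w ≤ (Measure.pi fun _ : Fin m => P.marginal).real
      (outerFit c (layerRel J) (Set.Ioo K.fst L.snd) q)) :
    w ≤ m ! * k * ((L.snd : ℝ) - K.fst) := by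
  set B := Set.Ioo K.fst L.snd with hB
  set t := (Finset.univ.filter fun i => c i = q).card with ht
  have hlt : K.fst < L.snd := hK'.trans (hKL.trans_lt hL')
  have hs : P.marginal.real B = (L.snd : ℝ) - K.fst := P.marginal_real_Ioo hlt.le
  have hspos : 0 < P.marginal.real B := hs ▸ sub_pos.2 hlt
  have hsat := hJ.saturated_Ioo hK hL
  have hgain := outerFit_mul_le P.marginal (B := B) Set.ordConnected_Ioo hsat hJ.isIntervalRel
    hc.monotone hq
  have hloss := sortedFit_diff_le P.marginal (B := B) Set.ordConnected_Ioo hsat hJ.isIntervalRel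
    hc.monotone hsurj he
  have hle := hJ.gain_le_loss hopt hc (B := B) Set.ordConnected_Ioo hsat
  set g := (P.marginal.prod P.marginal).real ({p | ¬ layerRel J p.1 p.2} ∩ B ×ˢ B) with hg
  have hgpos : 0 < g := prod_marginal_pos hK' hL' (by
    rintro ⟨u, v⟩ ⟨hu, hv⟩
    exact ⟨hJ.not_layerRel hK hL hKL hu hv, ⟨hu.1, hu.2.trans (hKL.trans_lt hL')⟩,
      hK'.trans (hKL.trans_lt hv.1), hv.2⟩)
  rw [← hs]
  have hpos : 0 < P.marginal.real B ^ (t - 2) * g := mul_pos (pow_pos hspos _) hgpos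
  refine le_of_mul_le_mul_right ?_ hpos
  calc w * (P.marginal.real B ^ (t - 2) * g)
      ≤ _ := mul_le_mul_of_nonneg_right hw hpos.le
    _ ≤ _ := hgain
    -- The loss has one more factor |B| than the gain; all else cancels.
    _ ≤ m ! * (k * (P.marginal.real B ^ (t + 1 - 2) * g)) :=
      mul_le_mul_of_nonneg_left (hle.trans hloss) (by positivity)
    _ = _ := by
      rw [show t + 1 - 2 = (t - 2) + 1 by omega, pow_succ]; ring

theorem prod_le_outerFit (hJ : P.HasLayers J) {q : Fin k} {Y : Fin k → NonemptyInterval unitInterval}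
    (hY : ∀ d, Y d ∈ J) (hY' : ∀ d d', d ≠ q → d' ≠ q → d < d' → (Y d).snd ≤ (Y d').fst)
    {B : Set unitInterval} (hlt : ∀ d < q, ∀ y ∈ B, (Y d).snd ≤ y)
    (hgt : ∀ d, q < d → ∀ y ∈ B, y ≤ (Y d).fst) :
    ∏ i, (if c i = q then 1 else ((Y (c i)).snd : ℝ) - (Y (c i)).fst) ≤
      (Measure.pi fun _ : Fin m => P.marginal).real (outerFit c (layerRel J) B q) := by
  have hsub : (Set.univ.pi fun i => if c i = q then Set.univ else
      Set.Ioo (Y (c i)).fst (Y (c i)).snd) ⊆ outerFit c (layerRel J) B q := by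
    intro x hx
    have hmem : ∀ a, c a ≠ q → x a ∈ Set.Ioo (Y (c a)).fst (Y (c a)).snd := by
      intro a ha
      simpa [ha] using hx a trivial
    refine ⟨fun a b ha hb => ⟨⟨fun h => ?_, fun h => ?_⟩, fun h => ?_⟩, fun a => ⟨?_, ?_⟩⟩
    · by_contra hne
      rcases lt_or_gt_of_ne hne with hlt | hlt
      · exact hJ.not_layerRel (hY _) (hY _) (hY' _ _ ha hb hlt) (hmem a ha) (hmem b hb) h
      · exact hJ.not_layerRel (hY _) (hY _) (hY' _ _ hb ha hlt) (hmem b hb) (hmem a ha)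
          (hJ.isIntervalRel.equivalence.symm h)
    · exact .inr ⟨Y (c a), hY _, hmem a ha, h ▸ hmem b hb⟩
    · exact (hmem a ha).2.trans ((hY' _ _ ha hb h).trans_lt (hmem b hb).1)
    · exact fun h y hy => (hmem a h.ne).2.trans_le (hlt _ h y hy)
    · exact fun h y hy => (hgt _ h y hy).trans_lt (hmem a h.ne').1
  refine le_trans (le_of_eq ?_) (measureReal_mono hsub)
  rw [Measure.real, Measure.pi_pi, ENNReal.toReal_prod]
  refine Finset.prod_congr rfl fun i _ => ?_
  split_ifs
  · simp
  · exact (P.marginal_real_Ioo (Y (c i)).fst_le_snd).symm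

theorem finite_nondegenerate (hJ : P.HasLayers J) (hopt : P.IsOptimal σ) (hc : IsLayerIndex σ c)
    (hsurj : Function.Surjective c) (hk : 0 < k)
    (hfirst : 2 ≤ (Finset.univ.filter fun i => c i = ⟨0, hk⟩).card)
    (hlast : 2 ≤ (Finset.univ.filter fun i => c i = ⟨k - 1, by omega⟩).card)
    (he : ∀ q : Fin k, q = ⟨0, hk⟩ ∨ q = ⟨k - 1, by omega⟩ → ∀ (d : ℕ) (hd : d + 1 < k),
      (Finset.univ.filter fun i => c i = q).card + 1 ≤
      (Finset.univ.filter fun i => c i = ⟨d, by omega⟩).card +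
      (Finset.univ.filter fun i => c i = ⟨d + 1, hd⟩).card) :
    {K ∈ J | K.fst < K.snd}.Finite := by
  by_contra hinf
  let f := Set.Infinite.natEmbedding _ hinf
  have hprod : ∀ (q : Fin k) (Y : Fin k → NonemptyInterval unitInterval),
      (∀ d, (Y d).fst < (Y d).snd) →
      0 < ∏ i, (if c i = q then 1 else ((Y (c i)).snd : ℝ) - (Y (c i)).fst) := by
    intro q Y hY
    refine Finset.prod_pos fun i _ => ?_
    split_ifs
    · exact one_pos
    · exact sub_pos.2 (hY _)
  have hmk : (0 : ℝ) < m ! * k := by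
    have : (0 : ℝ) < k := by exact_mod_cast hk
    positivity
  have htrans : IsTrans (NonemptyInterval unitInterval) fun K L => K.snd ≤ L.fst :=
    ⟨fun K L M h h' => h.trans (L.fst_le_snd.trans h')⟩
  -- Ramsey: the second alternative only denies the increasing order, and disjointness of interiors
  -- then turns it into the decreasing one.
  obtain ⟨g, hg⟩ := exists_increasing_or_nonincreasing_subseq
    (fun K L : NonemptyInterval unitInterval => K.snd ≤ L.fst) fun n => (f n).1
  set Z : ℕ → NonemptyInterval unitInterval := fun n => (f (g n)).1 with hZ
  have hZJ : ∀ n, Z n ∈ J := fun n => (f (g n)).2.1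
  have hZlt : ∀ n, (Z n).fst < (Z n).snd := fun n => (f (g n)).2.2
  rcases hg with hg | hg
  · have hinc : ∀ n n', n < n' → (Z n).snd ≤ (Z n').fst := hg
    set w := ∏ i, (if c i = ⟨k - 1, by omega⟩ then 1 else
      ((Z (c i)).snd : ℝ) - (Z (c i)).fst) with hw
    have hwpos : 0 < w := hprod _ (fun d => Z d) fun d => hZlt d
    have ha : Monotone fun n => ((Z n).fst : ℝ) := monotone_nat_of_le_succ fun n =>
      (hZlt n).le.trans (hinc n (n + 1) (Nat.lt_succ_self n))
    -- Starting at `k` puts the merged interval beyond the layers that hold the other blocks, so `w`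
    -- does not depend on `n`.
    obtain ⟨n, hn, hlt⟩ := exists_sub_lt_of_monotone ha
      ⟨1, by rintro _ ⟨n, rfl⟩; exact (Z n).fst.2.2⟩ (div_pos hwpos hmk) k
    have hle := hJ.le_of_outerFit hopt hc hsurj (q := ⟨k - 1, by omega⟩) hlast (he _ (.inr rfl))
      (hZJ n) (hZJ (n + 1)) (hZlt n) (hZlt (n + 1)) (hinc _ _ (Nat.lt_succ_self n))
      (hJ.prod_le_outerFit (Y := fun d => Z d) (fun d => hZJ d)
        (fun d d' _ _ h => hinc _ _ h)
        (fun d hd y hy => (hinc d n (by omega)).trans hy.1.le)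
        (fun d hd => absurd hd (by rw [Fin.lt_def]; simp only; omega)))
    have h2 : ((Z (n + 1)).snd : ℝ) ≤ (Z (n + 2)).fst := hinc (n + 1) (n + 2) (by omega)
    rw [lt_div_iff₀ hmk] at hlt
    have := mul_le_mul_of_nonneg_left (sub_le_sub_right h2 ((Z n).fst : ℝ)) hmk.le
    simp only [← hw] at hle
    linarith
  · have hdec : ∀ n n', n < n' → (Z n').snd ≤ (Z n).fst := by
      intro n n' hn
      have h1 : (Z n').fst < (Z n).snd := not_le.1 (hg n n' hn)
      by_contra! h2
      obtain ⟨u, hu1, hu2⟩ := exists_between (max_lt (lt_min (hZlt n) h2) (lt_min h1 (hZlt n')))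
      rw [max_lt_iff] at hu1
      rw [lt_min_iff] at hu2
      have := hJ.eq_of_mem (hZJ n) (hZJ n') (u := u) ⟨hu1.1, hu2.1⟩ ⟨hu1.2.le, hu2.2.le⟩
      exact hn.ne (g.injective (f.injective (Subtype.ext this)))
    -- The layers now run from right to left, so the block with index `d` goes to layer `k - d`.
    set w := ∏ i, (if c i = ⟨0, hk⟩ then 1 else
      ((Z (k - c i)).snd : ℝ) - (Z (k - c i)).fst) with hw
    have hwpos : 0 < w := hprod _ (fun d => Z (k - d)) fun d => hZlt _
    have ha : Monotone fun n => -((Z n).snd : ℝ) := monotone_nat_of_le_succ fun n =>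
      neg_le_neg ((hdec n (n + 1) (Nat.lt_succ_self n)).trans (hZlt n).le)
    obtain ⟨n, hn, hlt⟩ := exists_sub_lt_of_monotone ha
      ⟨0, by rintro _ ⟨n, rfl⟩; exact neg_nonpos.2 (Z n).snd.2.1⟩ (div_pos hwpos hmk) (k + 1)
    have hle := hJ.le_of_outerFit hopt hc hsurj (q := ⟨0, hk⟩) hfirst (he _ (.inl rfl))
      (hZJ (n + 1)) (hZJ n) (hZlt (n + 1)) (hZlt n) (hdec _ _ (Nat.lt_succ_self n))
      (hJ.prod_le_outerFit (Y := fun d => Z (k - d)) (fun d => hZJ _)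
        (fun d d' _ _ h => hdec _ _ (by omega))
        (fun d hd => absurd hd (by simp [Fin.lt_def]))
        (fun d hd y hy => hy.2.le.trans (hdec _ _ (by omega))))
    have h2 : ((Z (n + 2)).snd : ℝ) ≤ (Z (n + 1)).fst := hdec (n + 1) (n + 2) (by omega)
    rw [lt_div_iff₀ hmk] at hlt
    have := mul_le_mul_of_nonneg_left (sub_le_sub_left h2 ((Z n).snd : ℝ)) hmk.le
    simp only [← hw] at hle
    linarith

theorem not_trivial_on_Ioo (hJ : P.HasLayers J) (hopt : P.IsOptimal σ) (hc : IsLayerIndex σ c)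
    (hk : 0 < k)
    (hfirst : 2 ≤ (Finset.univ.filter fun i => c i = ⟨0, hk⟩).card)
    (hlast : 2 ≤ (Finset.univ.filter fun i => c i = ⟨k - 1, by omega⟩).card)
    (he : ∀ (d : ℕ) (hd : d + 1 < k), 3 ≤ (Finset.univ.filter fun i => c i = ⟨d, by omega⟩).card +
      (Finset.univ.filter fun i => c i = ⟨d + 1, hd⟩).card)
    {a b : unitInterval} (hab : a < b) :
    ¬ ∀ u ∈ Set.Ioo a b, ∀ v, layerRel J u v → u = v := by
  intro htriv
  set ν := Measure.pi fun _ : Fin m => P.marginal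
  have hnull : ∀ q, 2 ≤ (Finset.univ.filter fun i => c i = q).card → ∀ a' b', a ≤ a' → a' < b' →
      b' ≤ b → ν (outerFit c (layerRel J) (Set.Ioo a' b') q) = 0 := by
    intro q hq a' b' ha hab' hb
    have htriv' : ∀ u ∈ Set.Ioo a' b', ∀ v, layerRel J u v → u = v :=
      fun u hu => htriv u (Set.Ioo_subset_Ioo ha hb hu)
    have hsat : ∀ u v, layerRel J u v → u ∈ Set.Ioo a' b' → v ∈ Set.Ioo a' b' :=
      fun u v huv hu => htriv' u hu v huv ▸ hu
    have hgain := outerFit_mul_le P.marginal Set.ordConnected_Ioo hsat hJ.isIntervalRel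
      hc.monotone hq
    have hle := hJ.gain_le_loss hopt hc Set.ordConnected_Ioo hsat
    rw [Set.sdiff_eq_empty.2 (sortedFit_subset_of_trivial Set.ordConnected_Ioo htriv' hc.monotone he),
      measureReal_empty] at hle
    have hgain' := hgain.trans (mul_nonpos_of_nonneg_of_nonpos (by positivity) hle)
    obtain ⟨w, hw1, hw2⟩ := exists_between hab'
    have hpos := mul_pos (pow_pos (by
        rw [P.marginal_real_Ioo hab'.le]; exact sub_pos.2 hab' :
          0 < P.marginal.real (Set.Ioo a' b')) ((Finset.univ.filter fun i => c i = q).card - 2))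
      (prod_marginal_pos (P := P) (s := {p | ¬ layerRel J p.1 p.2} ∩
        Set.Ioo a' b' ×ˢ Set.Ioo a' b') hw1 hw2 (by
        rintro ⟨u, v⟩ ⟨hu, hv⟩
        have hu' : u ∈ Set.Ioo a' b' := ⟨hu.1, hu.2.trans hw2⟩
        exact ⟨fun h => (hu.2.trans hv.1).ne (htriv' u hu' v h), hu', hw1.trans hv.1, hv.2⟩))
    have h0 := nonpos_of_mul_nonpos_left hgain' hpos
    exact (measureReal_eq_zero_iff).1 (le_antisymm h0 measureReal_nonneg)
  -- A fitting tuple has at most one point in `(a, b)`, hence none in one of the two halves.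
  obtain ⟨w, hw1, hw2⟩ := exists_between hab
  have hsub : sortedFit c (layerRel J) ⊆
      ⋃ q ∈ {q : Fin k | 2 ≤ (Finset.univ.filter fun i => c i = q).card},
        (outerFit c (layerRel J) (Set.Ioo a w) q ∪ outerFit c (layerRel J) (Set.Ioo w b) q) := by
    intro x hx
    have hx' := sortedFit_subset_of_trivial Set.ordConnected_Ioo htriv hc.monotone he hx
    have hone : ∀ i j, x i ∈ Set.Ioo a b → x j ∈ Set.Ioo a b → x i = x j := fun i j hi hj =>
      htriv _ hi _ ((hx.2 i j).2 ((hx'.2 i j).1 (.inr ⟨hi, hj⟩)))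
    have hor : (∀ i, x i ≤ a ∨ w ≤ x i) ∨ (∀ i, x i ≤ w ∨ b ≤ x i) := by
      by_contra! h
      obtain ⟨⟨i, hi1, hi2⟩, ⟨j, hj1, hj2⟩⟩ := h
      exact (hi2.trans hj1).ne (hone i j ⟨hi1, hi2.trans hw2⟩ ⟨hw1.trans hj1, hj2⟩)
    rcases hor with h | h
    · obtain ⟨q, hq, hxq⟩ := exists_mem_outerFit hk hc.monotone hfirst hlast he hx h
      exact Set.mem_biUnion hq (.inl hxq)
    · obtain ⟨q, hq, hxq⟩ := exists_mem_outerFit hk hc.monotone hfirst hlast he hx h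
      exact Set.mem_biUnion hq (.inr hxq)
  have hpos := hJ.sortedFit_pos hopt hc
  have hzero : ν (sortedFit c (layerRel J)) = 0 := by
    refine measure_mono_null hsub ((measure_biUnion_null_iff (Set.toFinite _).countable).2 ?_)
    intro q hq
    exact measure_union_null (hnull q hq a w le_rfl hw1 hw2.le) (hnull q hq w b hw1.le hw2 le_rfl)
  rw [Measure.real, hzero] at hpos
  simp at hpos

theorem finite_of_covering (hJ : P.HasLayers J) (hfin : {K ∈ J | K.fst < K.snd}.Finite)
    (hcov : ∀ u : unitInterval, ∃ K ∈ J, K.fst < K.snd ∧ u ∈ Set.Icc K.fst K.snd) : J.Finite := by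
  refine (hfin.union ((hfin.image fun K => NonemptyInterval.pure K.fst).union
    (hfin.image fun K => NonemptyInterval.pure K.snd))).subset fun K hK => ?_
  rcases K.fst_le_snd.lt_or_eq with hlt | heq
  · exact .inl ⟨hK, hlt⟩
  obtain ⟨L, hL, hlt, hmem⟩ := hcov K.fst
  have hKp : ∀ u, u = K.fst → NonemptyInterval.pure u = K := by
    rintro u rfl
    exact NonemptyInterval.ext (Prod.ext rfl heq)
  have hnot : K.fst ∉ Set.Ioo L.fst L.snd := fun h => by
    obtain rfl := hJ.eq_of_mem hL hK h ⟨le_rfl, K.fst_le_snd⟩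
    exact h.1.false
  rcases hmem.1.lt_or_eq with h1 | h1
  · rcases hmem.2.lt_or_eq with h2 | h2
    · exact absurd ⟨h1, h2⟩ hnot
    · exact .inr (.inr ⟨L, ⟨hL, hlt⟩, hKp _ h2.symm⟩)
  · exact .inr (.inl ⟨L, ⟨hL, hlt⟩, hKp _ h1⟩)

end Permuton.HasLayers

theorem mainTheorem3 {m k : ℕ} (hk : 2 ≤ k) (σ : Equiv.Perm (Fin m)) (ℓ : Fin k → ℕ)
    (hσ : IsLayeredWith σ ℓ)
    (hfirst : 2 ≤ ℓ ⟨0, by omega⟩) (hlast : 2 ≤ ℓ ⟨k - 1, by omega⟩)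
    (hpair : ∀ (i : ℕ) (hi : i + 1 < k),
      max (ℓ ⟨0, by omega⟩) (ℓ ⟨k - 1, by omega⟩) + 1 ≤ ℓ ⟨i, by omega⟩ + ℓ ⟨i + 1, hi⟩)
    (P : Permuton) (hopt : P.IsOptimal σ)
    (J : Set (NonemptyInterval unitInterval)) (hJ : P.HasLayers J) :
    J.Finite := by
  obtain ⟨hℓ, c, hmono, hcard, hanti, hlt⟩ := hσ
  have hc : IsLayerIndex σ c := ⟨hmono, hanti, hlt⟩
  have hsurj : Function.Surjective c := fun d => by
    have := hℓ d
    rw [← hcard d, Finset.card_pos] at this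
    obtain ⟨i, hi⟩ := this
    exact ⟨i, by simpa using hi⟩
  have hfin := hJ.finite_nondegenerate hopt hc hsurj (by omega) (by rwa [hcard]) (by rwa [hcard])
    (by
      rintro q (rfl | rfl) d hd <;> rw [hcard, hcard, hcard]
      · exact (Nat.succ_le_succ (le_max_left _ _)).trans (hpair d hd)
      · exact (Nat.succ_le_succ (le_max_right _ _)).trans (hpair d hd))
  refine hJ.finite_of_covering hfin ?_
  by_contra! hcov
  obtain ⟨u, hu⟩ := hcov
  set C := ⋃ K ∈ {K ∈ J | K.fst < K.snd}, Set.Icc K.fst K.snd with hC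
  -- Finiteness of the set of nondegenerate layers makes their union closed.
  have hopen : IsOpen Cᶜ := (hfin.isClosed_biUnion fun K _ => isClosed_Icc).isOpen_compl
  have huC : u ∈ Cᶜ := fun h => by
    obtain ⟨K, hK, hmem⟩ := Set.mem_iUnion₂.1 h
    exact hu K hK.1 hK.2 hmem
  obtain ⟨a, b, hab, hsub⟩ := hopen.exists_Ioo_subset ⟨u, huC⟩
  refine hJ.not_trivial_on_Ioo hopt hc (by omega) (by rwa [hcard]) (by rwa [hcard])
    (fun d hd => ?_) hab ?_
  · rw [hcard, hcard]
    exact (Nat.succ_le_succ (hfirst.trans (le_max_left _ _))).trans (hpair d hd)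
  · rintro v hv w (h | ⟨K, hK, hvK, -⟩)
    · exact h
    · exact absurd (Set.mem_iUnion₂.2
        ⟨K, ⟨hK, hvK.1.trans hvK.2⟩, Set.Ioo_subset_Icc_self hvK⟩) (hsub hv)
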